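/- Let $(X,d)$ be a nonempty proper geodesic Gromov hyperbolic metric space. The Gromov boundary $\partial_G X$ is the set of geodesic rays $\gamma\colon[0,\infty)\to X$ modulo the relation that $t\mapsto d(\gamma(t),\sigma(t))$ is bounded. A sequence $(x_n)$ in $X$ converges to $\xi\in\partial_GX$ if, for every base point $p$ and geodesic segments $\gamma_n$ from $p$ to $x_n$ (extended to $[0,\infty)$ by the constant value $x_n$), every limit, uniform on compact sets, of a subsequence of $(\gamma_n)$ is a geodesic ray in the class $\xi$. A geodesic region with vertex $\xi$ is a set $A(\gamma,R)=\{x\in X: d(x,\gamma)<R\}$ with $R>0$ and $\gamma$ a geodesic ray with $[\gamma]=\xi$. A sequence $(x_n)_{n\ge0}$ is a discrete quasi-geodesic ray if there are $A\ge1$, $B\ge0$ with $A^{-1}|n-m|-B\le d(x_n,x_m)\le A|n-m|+B$ for all $n,m\ge0$. Let $f\colon X\to X$ be non-expanding, i.e. $d(f(x),f(y))\le d(x,y)$ for all $x,y\in X$. Its divergence rate is $c(f)=\lim_{n\to\infty} d(x,f^n(x))/n$ (independent of $x\in X$). A Denjoy--Wolff point of $f$ is a $\zeta\in\partial_GX$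 such that $f^n(x)\to\zeta$ for every $x\in X$. A backward orbit is a sequence $(z_n)_{n\ge0}$ with $f(z_{n+1})=z_n$ for all $n\geq 0$; it has bounded step if $\lim_n d(z_n,z_{n+1})<\infty$. For $\eta\in\partial_GX$ and $p\in X$ the dilation $\lambda_{\eta,p}$ is defined by $\log\lambda_{\eta,p}=\liminf_{z\to\eta}\,\bigl(d(z,p)-d(f(z),p)\bigr)$. The point $\eta$ is a boundary regular fixed point if $\lambda_{\eta,p}<+\infty$ for some (equivalently, every) $p$, and $f(x_n)\to\eta$ for every sequence $x_n\to\eta$ contained in a geodesic region with vertex $\eta$. Then: 1. If $c(f)>0$, then $f$ has a unique Denjoy--Wolff point $\zeta$, and every forward orbit $(f^n(x))_{n\ge0}$ is a discrete quasi-geodesic ray and is contained in a geodesic region with vertex $\zeta$. 2. If $c(f)>0$, then every backward orbit with bounded step is a discrete quasi-geodesic ray, converges to a point $\eta\in\partial_GX$ with $\eta\ne\zeta$, and is contained in a geodesic region with vertex $\eta$. 3. If $(z_n)$ is a backward orbit with bounded step converging to a boundary regular fixed point $\eta$, and $\lambda_{\eta,p}>1$ for some $p\in X$, then $(z_n)$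 is a discrete quasi-geodesic ray and is contained in a geodesic region with vertex $\eta$. -/

import Mathlib

open Filter Topology
open scoped NNReal ENNReal

namespace GromovDynamics

section Space

variable {X : Type*} [MetricSpace X]

/-- `γ` is a geodesic segment from `p` to `x`, parametrised by arc length on `[0, d(p,x)]` and
extended to `[0, ∞)` by the constant value `x`. -/
structure IsGeodesicSegment (p x : X) (γ : ℝ≥0 → X) : Prop where
  start : γ 0 = p
  isometric : ∀ s t : ℝ≥0, s ≤ nndist p x → t ≤ nndist p x →
    dist (γ s) (γ t) = dist s t
  stop_const : ∀ t : ℝ≥0, nndist p x ≤ t → γ t = x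

variable (X) in
/-- Every two points are joined by a geodesic segment. -/
def IsGeodesicSpace : Prop :=
  ∀ p x : X, ∃ γ : ℝ≥0 → X, IsGeodesicSegment p x γ

/-- The Gromov product `(x | y)_p`. -/
noncomputable def gromovProduct (p x y : X) : ℝ :=
  (dist x p + dist y p - dist x y) / 2

variable (X) in
/-- Gromov hyperbolicity: `(x|z)_p ≥ min ((x|y)_p) ((y|z)_p) - δ` for some `δ ≥ 0`. -/
def IsGromovHyperbolic : Prop :=
  ∃ δ : ℝ, 0 ≤ δ ∧ ∀ p x y z : X,
    min (gromovProduct p x y) (gromovProduct p y z) - δ ≤ gromovProduct p x z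

variable (X) in
/-- Geodesic rays: isometric embeddings of `[0, ∞)`. -/
structure GeodesicRay where
  toFun : ℝ≥0 → X
  isometry' : Isometry toFun

instance : CoeFun (GeodesicRay X) (fun _ => ℝ≥0 → X) := ⟨GeodesicRay.toFun⟩

/-- Two geodesic rays are asymptotic if `t ↦ d(γ(t), σ(t))` is bounded. -/
def Asymptotic (γ σ : GeodesicRay X) : Prop :=
  ∃ C : ℝ, ∀ t : ℝ≥0, dist (γ t) (σ t) ≤ C

variable (X) in
/-- Asymptoticity is an equivalence relation. -/
instance asymptoticSetoid : Setoid (GeodesicRay X) where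
  r := Asymptotic
  iseqv :=
    { refl := fun γ => ⟨0, fun t => by simp⟩
      symm := fun {γ σ} ⟨C, hC⟩ => ⟨C, fun t => by rw [dist_comm]; exact hC t⟩
      trans := fun {γ σ τ} ⟨C, hC⟩ ⟨D, hD⟩ =>
        ⟨C + D, fun t => (dist_triangle _ (σ t) _).trans (add_le_add (hC t) (hD t))⟩ }

variable (X) in
/-- The Gromov boundary: geodesic rays up to asymptoticity. -/
def GromovBoundary : Type _ := Quotient (asymptoticSetoid X)

/-- The class `[γ]` of a geodesic ray in the Gromov boundary. -/
def GeodesicRay.endpoint (γ : GeodesicRay X) : GromovBoundary X :=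
  Quotient.mk (asymptoticSetoid X) γ

/-- Convergence, in the Gromov compactification, of a sequence of points of `X` to a boundary
point `ξ`: if `γ n` is a geodesic segment from a base point `p` to `x n`, then every limit, uniform
on compact sets, of a subsequence of `γ` is a geodesic ray in the class `ξ`. -/
def ConvergesTo (x : ℕ → X) (ξ : GromovBoundary X) : Prop :=
  ∀ (p : X) (γ : ℕ → ℝ≥0 → X), (∀ n, IsGeodesicSegment p (x n) (γ n)) →
    ∀ φ : ℕ → ℕ, StrictMono φ → ∀ g : ℝ≥0 → X,
      (∀ K : Set ℝ≥0, IsCompact K → TendstoUniformlyOn (fun k => γ (φ k)) g atTop K) →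
      ∃ σ : GeodesicRay X, (∀ t, σ t = g t) ∧ σ.endpoint = ξ

/-- The trace on `X` of the neighbourhood filter of the boundary point `ξ` in the Gromov
compactification. As that compactification is metrizable, a set belongs to the trace if and only
if every sequence of `X` converging to `ξ` is eventually in the set. -/
def nhdsTrace (ξ : GromovBoundary X) : Filter X :=
  ⨆ (x : ℕ → X) (_ : ConvergesTo x ξ), map x atTop

/-- The geodesic region `A(γ, R)`. -/
def geodesicRegion (γ : GeodesicRay X) (R : ℝ) : Set X :=
  {x | Metric.infDist x (Set.range γ) < R}

/-- The sequence `x` is contained in a geodesic region with vertex `ξ`. -/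
def InGeodesicRegion (x : ℕ → X) (ξ : GromovBoundary X) : Prop :=
  ∃ (γ : GeodesicRay X) (R : ℝ), 0 < R ∧ γ.endpoint = ξ ∧ ∀ n, x n ∈ geodesicRegion γ R

/-- Discrete quasi-geodesic rays, for some constants `A ≥ 1`, `B ≥ 0`. -/
def IsDiscreteQuasiGeodesicRay (x : ℕ → X) : Prop :=
  ∃ A B : ℝ, 1 ≤ A ∧ 0 ≤ B ∧ ∀ n m : ℕ,
    A⁻¹ * |(n : ℝ) - m| - B ≤ dist (x n) (x m) ∧
      dist (x n) (x m) ≤ A * |(n : ℝ) - m| + B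

end Space

section Maps

variable {X : Type*} [MetricSpace X]

/-- The dilation `λ_{η,p} ∈ [0, ∞]` of `f` at `η` with respect to `p`:
`log λ_{η,p} = liminf_{z → η} (d(z,p) - d(f(z),p))`. -/
noncomputable def dilation (f : X → X) (η : GromovBoundary X) (p : X) : ℝ≥0∞ :=
  EReal.exp (liminf (fun z => ((dist z p - dist (f z) p : ℝ) : EReal)) (nhdsTrace η))

/-- `f` has geodesic limit `ξ` at `η`, for boundary points `η` and `ξ`. -/
def HasGeodesicLimit (f : X → X) (η ξ : GromovBoundary X) : Prop :=
  ∀ x : ℕ → X, ConvergesTo x η → InGeodesicRegion x η → ConvergesTo (fun n => f (x n)) ξ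

/-- Boundary regular fixed points: `λ_{η,p} < ∞` and `f` has geodesic limit `η` at `η`.
(For non-expanding `f` finiteness of the dilation does not depend on the base point.) -/
def IsBoundaryRegularFixedPoint (f : X → X) (η : GromovBoundary X) : Prop :=
  (∃ p : X, dilation f η p < ⊤) ∧ HasGeodesicLimit f η η

/-- `ζ` is a Denjoy--Wolff point of `f`: every forward orbit converges to `ζ`. -/
def IsDenjoyWolffPoint (f : X → X) (ζ : GromovBoundary X) : Prop :=
  ∀ x : X, ConvergesTo (fun n => f^[n] x) ζ

/-- The divergence rate `c(f) = lim d(x, f^n(x)) / n`. For non-expanding `f` the limit exists and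
does not depend on `x`; see `tendsto_divergenceRate`. -/
noncomputable def divergenceRate [Nonempty X] (f : X → X) : ℝ :=
  limUnder atTop
    (fun n : ℕ => dist (Classical.arbitrary X) (f^[n] (Classical.arbitrary X)) / n)

theorem tendsto_divergenceRate [Nonempty X] {f : X → X} (hf : LipschitzWith 1 f) (x : X) :
    Tendsto (fun n : ℕ => dist x (f^[n] x) / n) atTop (𝓝 (divergenceRate f)) := by
  have hit : ∀ (n : ℕ) (a b : X), dist (f^[n] a) (f^[n] b) ≤ dist a b := by
    intro n a b
    have h := (hf.iterate n).dist_le_mul a b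
    simpa using h
  set y : X := Classical.arbitrary X with hy
  have hsub : Subadditive (fun n : ℕ => dist y (f^[n] y)) := by
    intro m n
    have h1 := dist_triangle y (f^[m] y) (f^[m + n] y)
    have h2 := hit m y (f^[n] y)
    rw [← Function.iterate_add_apply] at h2
    exact h1.trans (by gcongr)
  have hbdd : BddBelow (Set.range fun n : ℕ => dist y (f^[n] y) / n) :=
    ⟨0, by rintro _ ⟨n, rfl⟩; positivity⟩
  have hlim : Tendsto (fun n : ℕ => dist y (f^[n] y) / n) atTop (𝓝 (divergenceRate f)) :=
    tendsto_nhds_limUnder ⟨_, hsub.tendsto_lim hbdd⟩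
  have hdiff : Tendsto (fun n : ℕ => dist x (f^[n] x) / n - dist y (f^[n] y) / n) atTop (𝓝 0) := by
    refine squeeze_zero_norm (a := fun n : ℕ => 2 * dist x y / n) ?_
      (tendsto_const_div_atTop_nhds_zero_nat _)
    intro n
    rw [← sub_div, Real.norm_eq_abs, abs_div, Nat.abs_cast]
    gcongr
    have h3 := hit n x y
    have h4 := dist_dist_dist_le x (f^[n] x) y (f^[n] y)
    rw [Real.dist_eq] at h4
    linarith
  simpa using hdiff.add hlim

/-- Backward orbits. -/
def IsBackwardOrbit (f : X → X) (z : ℕ → X) : Prop :=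
  ∀ n, f (z (n + 1)) = z n

/-- The backward `m`-step `σ_m = lim d(z_n, z_{n+m}) ∈ [0, ∞]`. The limit exists for backward
orbits of a non-expanding map; see `tendsto_backwardStep`. -/
noncomputable def backwardStep (m : ℕ) (z : ℕ → X) : ℝ≥0∞ :=
  limUnder atTop (fun n : ℕ => edist (z n) (z (n + m)))

theorem tendsto_backwardStep {f : X → X} (hf : LipschitzWith 1 f) {z : ℕ → X}
    (hz : IsBackwardOrbit f z) (m : ℕ) :
    Tendsto (fun n : ℕ => edist (z n) (z (n + m))) atTop (𝓝 (backwardStep m z)) := by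
  have hmono : Monotone (fun n : ℕ => edist (z n) (z (n + m))) := by
    refine monotone_nat_of_le_succ fun n => ?_
    have h := hf (z (n + 1)) (z (n + m + 1))
    rw [hz, hz] at h
    have e : n + 1 + m = n + m + 1 := by omega
    simpa [e] using h
  exact tendsto_nhds_limUnder ⟨_, tendsto_atTop_iSup hmono⟩

/-- Bounded step: `σ_1 < ∞`. -/
def HasBoundedStep (z : ℕ → X) : Prop :=
  backwardStep 1 z < ⊤

end Maps

end GromovDynamics

/-! All three claims reduce to one principle: in a hyperbolic space, a sequence with bounded steps,
convergent `m`-steps and linear lower bounds `c * m` past some index is a quasi-geodesic that stays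
near a geodesic ray.

Non-expansion makes `m`-steps monotone along orbits, so their limits `s m` exist and are
subadditive, and `s m / m` tends to some `l > 0`. For large `N` the asymptotic step `s (2 * N)`
exceeds `s N` by as much as desired, so the sequence sampled every `N` terms nearly does not
backtrack. The four-point inequality propagates this to all triples
(`HyperbolicWith.aligned_of_progress`, `HyperbolicWith.aligned_of_linear`). A limit of segments from
`x 0` to `x n` is then the required ray, and its class is the limit of the sequence
(`exists_convergesTo_of_linear`).

The linear bound comes from `c(f) > 0`, because by Fekete `c(f) * n` bounds every `n`-step
displacement, or from a dilation above one, because each backward step then gains a fixed distance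
from `p`. Finally `η ≠ ζ`: a common endpoint would keep `z n` at bounded distance from the forward
orbit of `z 0`, although `f^[m] (z 0)` is `n + m` iterates of `z n` and hence at least `c(f) * (n +
m)` away. -/

namespace GromovDynamics

/-! ### Four-point inequality and local-to-global alignment -/

section Hyperbolic

variable {X : Type*} [MetricSpace X]

variable (X) in
/-- Gromov hyperbolicity with a prescribed constant. -/
def HyperbolicWith (δ : ℝ) : Prop :=
  ∀ p x y z : X,
    min (gromovProduct p x y) (gromovProduct p y z) - δ ≤ gromovProduct p x z

/-- Clearing the Gromov products turns the minimum into a disjunction of linear inequalities. In the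
progress arguments below one alternative is contradictory and the other gives the estimate. -/
theorem HyperbolicWith.four_point {δ : ℝ} (h : HyperbolicWith X δ) (p x y z : X) :
    dist x z + dist y p ≤ dist x y + dist z p + 2 * δ ∨
      dist x z + dist y p ≤ dist y z + dist x p + 2 * δ := by
  have := h p x y z
  unfold gromovProduct at this
  rcases min_cases ((dist x p + dist y p - dist x y) / 2)
    ((dist y p + dist z p - dist y z) / 2) with h1 | h1
  · left; linarith [h1.1]
  · right; linarith [h1.1]

/-- A broken geodesic on which every two consecutive steps make definite progress escapes from
its starting point. -/
theorem HyperbolicWith.dist_add_le_of_progress {δ a G : ℝ} (h : HyperbolicWith X δ) (ha : 0 < a)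
    (hG : 2 * δ + a ≤ G) (hδ : 0 ≤ δ) {y : ℕ → X} {n : ℕ} (hn : 2 ≤ n)
    (hy : ∀ i, i + 2 ≤ n → dist (y i) (y (i + 1)) + G ≤ dist (y i) (y (i + 2)) ∧
      dist (y (i + 1)) (y (i + 2)) + G ≤ dist (y i) (y (i + 2))) (j : ℕ) (hj : j + 1 ≤ n) :
    dist (y 0) (y j) + a ≤ dist (y 0) (y (j + 1)) := by
  induction j with
  | zero =>
    have h0 := (hy 0 hn).2
    have h1 := dist_triangle (y 0) (y 1) (y 2)
    simp only [zero_add, dist_self] at *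
    linarith
  | succ j ih =>
    have h0 := ih (by omega)
    obtain ⟨h1, h2⟩ := hy j hj
    rcases h.four_point (y j) (y 0) (y (j + 2)) (y (j + 1)) with h3 | h3
    · rw [dist_comm (y (j + 2)) (y j), dist_comm (y (j + 1)) (y j)] at h3
      linarith
    · rw [dist_comm (y (j + 2)) (y j), dist_comm (y (j + 2)) (y (j + 1))] at h3
      linarith

/-- Local-to-global principle: a sequence whose consecutive pairs of steps make definite progress
has uniformly bounded Gromov products. -/
theorem HyperbolicWith.aligned_of_progress {δ L : ℝ} (h : HyperbolicWith X δ)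
    (hδ : 0 ≤ δ) {y : ℕ → X} (hL : ∀ i, dist (y i) (y (i + 1)) ≤ L)
    (hy : ∀ i, dist (y i) (y (i + 1)) + (4 * δ + 1) ≤ dist (y i) (y (i + 2)) ∧
      dist (y (i + 1)) (y (i + 2)) + (4 * δ + 1) ≤ dist (y i) (y (i + 2)))
    {i j k : ℕ} (hij : i < j) (hjk : j < k) :
    dist (y i) (y j) + dist (y j) (y k) ≤ dist (y i) (y k) + (L + 4 * δ) := by
  obtain ⟨j, rfl⟩ : ∃ j', j = j' + 1 := ⟨j - 1, by omega⟩
  have A : dist (y i) (y j) + (2 * δ + 1) ≤ dist (y i) (y (j + 1)) := by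
    have := h.dist_add_le_of_progress (a := 2 * δ + 1) (G := 4 * δ + 1) (by linarith)
      (by linarith) hδ (y := fun l => y (i + l)) (n := j - i + 2) (by omega)
      (fun l _ => hy (i + l)) (j - i) (by omega)
    have e : i + (j - i) = j := by omega
    have e' : i + (j - i + 1) = j + 1 := by omega
    simpa [e, e'] using this
  -- The same escape estimate for the reversed sequence; only indices `l ≤ k` occur, so truncated
  -- subtraction is harmless.
  have B : dist (y k) (y (j + 2)) + (2 * δ + 1) ≤ dist (y k) (y (j + 1)) := by
    have := h.dist_add_le_of_progress (a := 2 * δ + 1) (G := 4 * δ + 1) (by linarith)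
      (by linarith) hδ (y := fun l => y (k - l)) (n := k) (by omega)
      (fun l hl => by
        have := hy (k - l - 2)
        have e : k - l - 2 + 1 = k - (l + 1) := by omega
        have e' : k - l - 2 + 2 = k - l := by omega
        have e'' : k - l - 2 = k - (l + 2) := by omega
        rw [e, e', e''] at this
        simp only [dist_comm (y (k - l))]
        rw [dist_comm (y (k - (l + 1))) (y (k - (l + 2)))]
        exact this.symm) (k - (j + 2)) (by omega)
    have e : k - (k - (j + 2)) = j + 2 := by omega
    have e' : k - (k - (j + 2) + 1) = j + 1 := by omega
    simpa [e, e'] using this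
  obtain ⟨C1, C2⟩ := hy j
  have C3 := hL j
  have e1 := dist_comm (y (j + 2)) (y (j + 1))
  have e2 := dist_comm (y (j + 1)) (y k)
  have e3 := dist_comm (y j) (y i)
  have e4 := dist_comm (y k) (y (j + 2))
  -- `A` excludes the first alternative, so `y i`, `y (j + 1)`, `y (j + 2)` are aligned up to `L`.
  -- `B` then allows `y (j + 2)` to be replaced by `y k`.
  rcases h.four_point (y (j + 1)) (y j) (y i) (y (j + 2)) with h1 | h1
  · linarith
  · rcases h.four_point (y (j + 1)) (y i) (y k) (y (j + 2)) with h2 | h2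
    · linarith
    · linarith

theorem dist_le_mul_of_step {x : ℕ → X} {C : ℝ} (hC : ∀ n, dist (x n) (x (n + 1)) ≤ C) (n m : ℕ) :
    dist (x n) (x (n + m)) ≤ C * m := by
  induction m with
  | zero => simp
  | succ m ih =>
    have h1 := dist_triangle (x n) (x (n + m)) (x (n + m + 1))
    have h2 := hC (n + m)
    push_cast
    rw [← add_assoc]
    linarith

theorem dist_le_mul_abs_of_step {x : ℕ → X} {C : ℝ} (hC : ∀ n, dist (x n) (x (n + 1)) ≤ C)
    (n m : ℕ) : dist (x n) (x m) ≤ C * |(n : ℝ) - m| := by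
  rcases le_total n m with hnm | hnm
  · obtain ⟨k, rfl⟩ := Nat.exists_eq_add_of_le hnm
    simpa using dist_le_mul_of_step hC n k
  · obtain ⟨k, rfl⟩ := Nat.exists_eq_add_of_le hnm
    rw [dist_comm]
    simpa using dist_le_mul_of_step hC m k

/-- A sequence with bounded steps whose asymptotic `m`-steps grow linearly has uniformly bounded
Gromov products. -/
theorem HyperbolicWith.aligned_of_linear {δ C c : ℝ} (h : HyperbolicWith X δ) (hδ : 0 ≤ δ)
    {x : ℕ → X} (hC : ∀ n, dist (x n) (x (n + 1)) ≤ C) {s : ℕ → ℝ}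
    (hs : ∀ m, Tendsto (fun n => dist (x n) (x (n + m))) atTop (𝓝 (s m)))
    (hc : 0 < c) (hcs : ∀ m, c * m ≤ s m) :
    ∃ K : ℝ, 0 ≤ K ∧ ∀ i j k : ℕ, i ≤ j → j ≤ k →
      dist (x i) (x j) + dist (x j) (x k) ≤ dist (x i) (x k) + K := by
  have hC0 : 0 ≤ C := dist_nonneg.trans (hC 0)
  have hsub : Subadditive s := by
    intro m n
    have h1 : Tendsto (fun l => dist (x (l + m)) (x (l + m + n))) atTop (𝓝 (s n)) :=
      (hs n).comp (tendsto_add_atTop_nat m)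
    refine le_of_tendsto_of_tendsto' (hs (m + n)) ((hs m).add h1) fun l => ?_
    rw [← add_assoc]
    exact dist_triangle _ _ _
  have hbdd : BddBelow (Set.range fun n : ℕ => s n / n) := by
    refine ⟨0, ?_⟩
    rintro _ ⟨n, rfl⟩
    have := hcs n
    exact div_nonneg (le_trans (by positivity) this) (by positivity)
  set l := hsub.lim with hl
  have hlim := hsub.tendsto_lim hbdd
  have hlpos : 0 < l := by
    refine lt_of_lt_of_le hc (ge_of_tendsto hlim ?_)
    filter_upwards [eventually_gt_atTop 0] with n hn
    rw [le_div_iff₀ (by exact_mod_cast hn)]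
    exact hcs n
  -- Since `2 * l * N ≤ s (2 * N)`, these bounds give `s (2 * N) - s N ≥ 4 * δ + 3`. Replacing the
  -- two limits by actual distances costs at most 2, leaving the required `4 * δ + 1`.
  obtain ⟨N, hN1, hN2, hN3⟩ : ∃ N : ℕ, 0 < N ∧ s N / N < 3 / 2 * l ∧ 4 * δ + 3 ≤ l / 2 * N := by
    have e1 : ∀ᶠ N : ℕ in atTop, s N / N < 3 / 2 * l :=
      hlim.eventually_lt_const (by linarith)
    have e2 : ∀ᶠ N : ℕ in atTop, 4 * δ + 3 ≤ l / 2 * N :=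
      (tendsto_natCast_atTop_atTop.const_mul_atTop (by linarith : 0 < l / 2)).eventually_ge_atTop _
    obtain ⟨N, h1, h2, h3⟩ := ((eventually_gt_atTop 0).and (e1.and e2)).exists
    exact ⟨N, h1, h2, h3⟩
  have hNpos : (0 : ℝ) < N := by exact_mod_cast hN1
  have hsN : s N ≤ 3 / 2 * l * N := by
    rw [div_lt_iff₀ hNpos] at hN2
    exact hN2.le
  have hs2N : 2 * l * N ≤ s (2 * N) := by
    have := hsub.lim_le_div hbdd (n := 2 * N) (by omega)
    rw [← hl, le_div_iff₀ (by push_cast; linarith)] at this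
    push_cast at this
    linarith
  obtain ⟨n₀, hn₀⟩ : ∃ n₀, ∀ n ≥ n₀, dist (x n) (x (n + N)) < s N + 1 ∧
      s (2 * N) - 1 < dist (x n) (x (n + 2 * N)) :=
    eventually_atTop.1 (((hs N).eventually_lt_const (by linarith)).and
      ((hs (2 * N)).eventually_const_lt (by linarith)))
  have hal : ∀ i j k : ℕ, i < j → j < k →
      dist (x (n₀ + i * N)) (x (n₀ + j * N)) + dist (x (n₀ + j * N)) (x (n₀ + k * N)) ≤
        dist (x (n₀ + i * N)) (x (n₀ + k * N)) + (s N + 1 + 4 * δ) := by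
    intro i j k hij hjk
    refine h.aligned_of_progress hδ (y := fun i => x (n₀ + i * N)) ?_ ?_ hij hjk
    · intro i
      have := (hn₀ (n₀ + i * N) (by omega)).1
      have e : n₀ + (i + 1) * N = n₀ + i * N + N := by ring
      simp only [e]
      exact this.le
    · intro i
      have h1 := (hn₀ (n₀ + i * N) (by omega)).1
      have h2 := (hn₀ (n₀ + i * N + N) (by omega)).1
      have h3 := (hn₀ (n₀ + i * N) (by omega)).2
      have e : n₀ + (i + 1) * N = n₀ + i * N + N := by ring
      have e' : n₀ + (i + 2) * N = n₀ + i * N + N + N := by ring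
      have e'' : n₀ + i * N + 2 * N = n₀ + i * N + N + N := by ring
      simp only [e, e']
      rw [e''] at h3
      constructor <;> linarith
  have hs0 : 0 ≤ s N := le_trans (by positivity) (hcs N)
  have hal' : ∀ i j k : ℕ, i ≤ j → j ≤ k →
      dist (x (n₀ + i * N)) (x (n₀ + j * N)) + dist (x (n₀ + j * N)) (x (n₀ + k * N)) ≤
        dist (x (n₀ + i * N)) (x (n₀ + k * N)) + (s N + 1 + 4 * δ) := by
    intro i j k hij hjk
    rcases hij.eq_or_lt with rfl | hij
    · rw [dist_self]; linarith
    rcases hjk.eq_or_lt with rfl | hjk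
    · rw [dist_self]; linarith
    exact hal i j k hij hjk
  -- Bounds the distance from `x i` to its nearby sample. Each of the three points enters twice in
  -- the final estimate, hence `6 * D`.
  set D : ℝ := C * (n₀ + N) with hD
  have hnear : ∀ i, dist (x i) (x (n₀ + (i - n₀) / N * N)) ≤ D := by
    intro i
    refine (dist_le_mul_abs_of_step hC _ _).trans ?_
    refine mul_le_mul_of_nonneg_left ?_ hC0
    have h1 := Nat.div_mul_le_self (i - n₀) N
    have h2 := Nat.lt_div_mul_add (a := i - n₀) hN1
    set q := (i - n₀) / N * N
    rw [abs_le]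
    constructor
    · have : n₀ + q ≤ i + n₀ + N := by omega
      have : ((n₀ + q : ℕ) : ℝ) ≤ ((i + n₀ + N : ℕ) : ℝ) := by exact_mod_cast this
      push_cast at this ⊢
      linarith
    · have : i ≤ n₀ + q + n₀ + N := by omega
      have : (i : ℝ) ≤ ((n₀ + q + n₀ + N : ℕ) : ℝ) := by exact_mod_cast this
      push_cast at this ⊢
      linarith
  have hD0 : 0 ≤ D := by positivity
  refine ⟨s N + 1 + 4 * δ + 6 * D, by linarith, fun i j k hij hjk => ?_⟩
  have h1 := hal' ((i - n₀) / N) ((j - n₀) / N) ((k - n₀) / N)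
    (Nat.div_le_div_right (by omega)) (Nat.div_le_div_right (by omega))
  have hi := hnear i
  have hj := hnear j
  have hk := hnear k
  set a := x (n₀ + (i - n₀) / N * N)
  set b := x (n₀ + (j - n₀) / N * N)
  set d := x (n₀ + (k - n₀) / N * N)
  have t1 := dist_triangle4 (x i) a b (x j)
  have t2 := dist_triangle4 (x j) b d (x k)
  have t3 := dist_triangle4 a (x i) (x k) d
  rw [dist_comm b (x j)] at t1
  rw [dist_comm d (x k)] at t2
  rw [dist_comm a (x i)] at t3
  linarith

end Hyperbolic

/-! ### Limits of geodesic segments, geodesic regions and boundary points -/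

section Segments

variable {X : Type*} [MetricSpace X]

theorem IsGeodesicSegment.eq_min {p x : X} {γ : ℝ≥0 → X} (h : IsGeodesicSegment p x γ) (t : ℝ≥0) :
    γ t = γ (min t (nndist p x)) := by
  rcases le_total t (nndist p x) with ht | ht
  · rw [min_eq_left ht]
  · rw [min_eq_right ht, h.stop_const t ht, h.stop_const _ le_rfl]

theorem IsGeodesicSegment.lipschitz {p x : X} {γ : ℝ≥0 → X} (h : IsGeodesicSegment p x γ) :
    LipschitzWith 1 γ := by
  refine LipschitzWith.of_dist_le_mul fun s t => ?_
  rw [h.eq_min s, h.eq_min t, h.isometric _ _ (min_le_right _ _) (min_le_right _ _)]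
  simp only [NNReal.coe_one, one_mul, NNReal.dist_eq, NNReal.coe_min]
  refine (abs_min_sub_min_le_max _ _ _ _).trans ?_
  simp

theorem IsGeodesicSegment.dist_start {p x : X} {γ : ℝ≥0 → X} (h : IsGeodesicSegment p x γ)
    {t : ℝ≥0} (ht : t ≤ nndist p x) : dist p (γ t) = t := by
  have := h.isometric 0 t (zero_le) ht
  rw [h.start] at this
  simpa [NNReal.dist_eq] using this

theorem IsGeodesicSegment.dist_end {p x : X} {γ : ℝ≥0 → X} (h : IsGeodesicSegment p x γ)
    {t : ℝ≥0} (ht : t ≤ nndist p x) : dist (γ t) x = dist p x - t := by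
  have := h.isometric t (nndist p x) ht le_rfl
  rw [h.stop_const _ le_rfl, NNReal.dist_eq, abs_sub_comm, abs_of_nonneg] at this
  · simpa using this
  · exact sub_nonneg.2 ht

/-- Arzelà-Ascoli for geodesic segments issued from a point. -/
theorem exists_subseq_tendsto_segments [ProperSpace X] {p : X} {x : ℕ → X} {γ : ℕ → ℝ≥0 → X}
    (hγ : ∀ n, IsGeodesicSegment p (x n) (γ n)) :
    ∃ φ : ℕ → ℕ, StrictMono φ ∧ ∃ g : ℝ≥0 → X,
      ∀ K : Set ℝ≥0, IsCompact K → TendstoUniformlyOn (fun k => γ (φ k)) g atTop K := by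
  let S : Set C(ℝ≥0, X) := {g | LipschitzWith 1 g ∧ g 0 = p}
  have hS : IsCompact S := by
    let S' : Set (ℝ≥0 → X) := {g | LipschitzWith 1 g ∧ g 0 = p}
    have hS' : IsCompact S' := by
      -- Tychonoff: 1-Lipschitz maps with value `p` at 0 send `t` into the compact ball of radius
      -- `t`. Equicontinuity then upgrades pointwise to locally uniform convergence.
      refine (isCompact_univ_pi fun t : ℝ≥0 => isCompact_closedBall p (t : ℝ)).of_isClosed_subset
        ?_ ?_
      · refine IsClosed.inter ?_ (isClosed_singleton.preimage (continuous_apply (0 : ℝ≥0)))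
        have : {g : ℝ≥0 → X | LipschitzWith 1 g} =
            ⋂ s : ℝ≥0, ⋂ t : ℝ≥0, {g | dist (g s) (g t) ≤ dist s t} := by
          ext g
          simp [lipschitzWith_iff_dist_le_mul]
        change IsClosed {g : ℝ≥0 → X | LipschitzWith 1 g}
        rw [this]
        exact isClosed_iInter fun s => isClosed_iInter fun t =>
          isClosed_le (by fun_prop) continuous_const
      · rintro g ⟨hg, hg0⟩ t -
        have := hg.dist_le_mul t 0
        simpa [hg0, NNReal.dist_eq] using this
    refine ArzelaAscoli.isCompact_of_equicontinuous S ?_ ?_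
    · convert hS' using 1
      ext g
      constructor
      · rintro ⟨g, hg, rfl⟩
        exact hg
      · intro hg
        exact ⟨⟨g, hg.1.continuous⟩, hg, rfl⟩
    · exact (LipschitzWith.uniformEquicontinuous (K := 1) _ fun g => g.2.1).equicontinuous
  let G : ℕ → C(ℝ≥0, X) := fun n => ⟨γ n, (hγ n).lipschitz.continuous⟩
  obtain ⟨g, -, φ, hφ, hlim⟩ := hS.tendsto_subseq (x := G) fun n => ⟨(hγ n).lipschitz, (hγ n).start⟩
  exact ⟨φ, hφ, g, ContinuousMap.tendsto_iff_forall_isCompact_tendstoUniformlyOn.1 hlim⟩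

theorem isometry_of_tendsto_segments {p : X} {x : ℕ → X} {γ : ℕ → ℝ≥0 → X}
    (hγ : ∀ n, IsGeodesicSegment p (x n) (γ n))
    (hx : Tendsto (fun n => dist p (x n)) atTop atTop) {g : ℝ≥0 → X}
    (hg : ∀ t, Tendsto (fun n => γ n t) atTop (𝓝 (g t))) : Isometry g := by
  refine Isometry.of_dist_eq fun s t => ?_
  refine tendsto_nhds_unique ((hg s).dist (hg t)) (tendsto_const_nhds.congr' ?_)
  filter_upwards [hx.eventually_ge_atTop (s : ℝ), hx.eventually_ge_atTop (t : ℝ)] with n hs ht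
  exact ((hγ n).isometric s t hs ht).symm

theorem GeodesicRay.dist_zero (γ : GeodesicRay X) (t : ℝ≥0) : dist (γ 0) (γ t) = t := by
  rw [γ.isometry'.dist_eq]
  simp [NNReal.dist_eq]

theorem tendsto_dist_of_tendsto_dist {x : ℕ → X} {o : X}
    (hx : Tendsto (fun n => dist o (x n)) atTop atTop) (p : X) :
    Tendsto (fun n => dist p (x n)) atTop atTop := by
  refine tendsto_atTop_mono (fun n => ?_) (tendsto_atTop_add_const_right _ (-dist o p) hx)
  linarith [dist_triangle o p (x n)]

theorem exists_dist_lt_of_mem_geodesicRegion {γ : GeodesicRay X} {R : ℝ} {y : X}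
    (h : y ∈ geodesicRegion γ R) : ∃ s : ℝ≥0, dist y (γ s) < R := by
  obtain ⟨_, ⟨s, rfl⟩, hs⟩ := (Metric.infDist_lt_iff (Set.range_nonempty _)).1 h
  exact ⟨s, hs⟩

/-- An unbounded sequence in a geodesic region converges to its vertex. -/
theorem HyperbolicWith.convergesTo_of_region {δ : ℝ} (h : HyperbolicWith X δ) {x : ℕ → X}
    {γ : GeodesicRay X} {R : ℝ} (hR : ∀ n, x n ∈ geodesicRegion γ R) {o : X}
    (hx : Tendsto (fun n => dist o (x n)) atTop atTop) : ConvergesTo x γ.endpoint := by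
  intro p c hc φ hφ g hg
  have hpt : ∀ t, Tendsto (fun k => c (φ k) t) atTop (𝓝 (g t)) := fun t =>
    (hg {t} isCompact_singleton).tendsto_at rfl
  have hx' : ∀ q, Tendsto (fun k => dist q (x (φ k))) atTop atTop := fun q =>
    (tendsto_dist_of_tendsto_dist hx q).comp hφ.tendsto_atTop
  refine ⟨⟨g, isometry_of_tendsto_segments (fun k => hc (φ k)) (hx' p) hpt⟩, fun t => rfl,
    Quotient.sound ?_⟩
  refine ⟨3 * dist p (γ 0) + 2 * R + 2 * δ, fun t => ?_⟩
  refine le_of_tendsto ((hpt t).dist tendsto_const_nhds) ?_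
  filter_upwards [(hx' p).eventually_ge_atTop (t : ℝ),
    (hx' (γ 0)).eventually_ge_atTop (t + R : ℝ)] with k h1 h2
  obtain ⟨s, hs⟩ := exists_dist_lt_of_mem_geodesicRegion (hR (φ k))
  set b := c (φ k) t
  have hb1 : dist p b = t := (hc (φ k)).dist_start h1
  have hb2 : dist b (x (φ k)) = dist p (x (φ k)) - t := (hc (φ k)).dist_end h1
  have hγt := γ.dist_zero t
  have hγs := γ.dist_zero s
  have hts : (t : ℝ) ≤ s := by
    have := dist_triangle (γ 0) (γ s) (x (φ k))
    rw [dist_comm (γ s)] at this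
    linarith
  have hst : dist (γ t) (γ s) = s - t := by
    rw [γ.isometry'.dist_eq, NNReal.dist_eq, abs_sub_comm, abs_of_nonneg (by linarith)]
  have t1 := dist_triangle (γ s) (x (φ k)) b
  have t2 := dist_triangle p (γ 0) (x (φ k))
  have t3 := dist_triangle (γ 0) (γ s) (x (φ k))
  have t4 := dist_triangle (γ 0) p b
  rw [dist_comm (γ s) (x (φ k)), dist_comm _ b] at t1
  rw [dist_comm (γ s) (x (φ k))] at t3
  rw [dist_comm (γ 0) p] at t4
  have e1 := dist_comm (γ 0) b
  have e2 := dist_comm (γ 0) (γ t)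
  have e3 := dist_comm (γ 0) (γ s)
  have e4 := dist_comm (γ t) b
  have e5 := dist_comm (γ s) b
  have e6 := dist_comm (x (φ k)) b
  have hD : 0 ≤ dist p (γ 0) := dist_nonneg
  have hR0 : 0 ≤ R := dist_nonneg.trans hs.le
  -- Both `b` and `γ t` lie at distance about `t` along almost geodesic paths from `γ 0` to `γ s`,
  -- so they are close.
  rcases h.four_point (γ 0) (γ t) (γ s) b with h3 | h3
  · change dist b (γ t) ≤ _
    linarith
  · change dist b (γ t) ≤ _
    linarith

/-- Limits in the boundary are unique. -/
theorem ConvergesTo.unique [ProperSpace X] (hgeod : IsGeodesicSpace X) {x : ℕ → X}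
    {ξ ξ' : GromovBoundary X} (h : ConvergesTo x ξ) (h' : ConvergesTo x ξ') : ξ = ξ' := by
  choose c hc using fun n => hgeod (x 0) (x n)
  -- Convergence only constrains subsequential limits that exist; compactness supplies one.
  obtain ⟨φ, hφ, g, hg⟩ := exists_subseq_tendsto_segments hc
  obtain ⟨σ, hσ, rfl⟩ := h (x 0) c hc φ hφ g hg
  obtain ⟨σ', hσ', rfl⟩ := h' (x 0) c hc φ hφ g hg
  exact Quotient.sound ⟨0, fun t => by rw [hσ, hσ', dist_self]⟩

/-- An unbounded sequence with uniformly bounded Gromov products stays near a geodesic ray. -/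
theorem HyperbolicWith.exists_region_of_aligned [ProperSpace X] {δ K : ℝ}
    (h : HyperbolicWith X δ) (hδ : 0 ≤ δ) (hgeod : IsGeodesicSpace X) {x : ℕ → X} (hK : 0 ≤ K)
    (hal : ∀ i j k : ℕ, i ≤ j → j ≤ k →
      dist (x i) (x j) + dist (x j) (x k) ≤ dist (x i) (x k) + K)
    (hx : Tendsto (fun n => dist (x 0) (x n)) atTop atTop) :
    ∃ (γ : GeodesicRay X) (R : ℝ), 0 < R ∧ ∀ n, x n ∈ geodesicRegion γ R := by
  choose c hc using fun n => hgeod (x 0) (x n)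
  obtain ⟨φ, hφ, g, hg⟩ := exists_subseq_tendsto_segments hc
  have hpt : ∀ t, Tendsto (fun k => c (φ k) t) atTop (𝓝 (g t)) := fun t =>
    (hg {t} isCompact_singleton).tendsto_at rfl
  have hx' := hx.comp hφ.tendsto_atTop
  refine ⟨⟨g, isometry_of_tendsto_segments (fun k => hc (φ k)) hx' hpt⟩, K + 2 * δ + 1,
    by linarith, fun m => ?_⟩
  -- `x m` is compared with the ray point at the same distance from `x 0`.
  refine (Metric.infDist_lt_iff (Set.range_nonempty _)).2 ⟨_, ⟨nndist (x 0) (x m), rfl⟩, ?_⟩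
  refine lt_of_le_of_lt ?_ (lt_add_one _)
  refine le_of_tendsto (tendsto_const_nhds.dist (hpt (nndist (x 0) (x m)))) ?_
  filter_upwards [hx'.eventually_ge_atTop (dist (x 0) (x m)),
    hφ.tendsto_atTop.eventually_ge_atTop m] with k h1 h2
  have h1' : nndist (x 0) (x m) ≤ nndist (x 0) (x (φ k)) := h1
  have b1 := (hc (φ k)).dist_start h1'
  have b2 := (hc (φ k)).dist_end h1'
  rw [coe_nndist] at b1 b2
  have a1 := hal 0 m (φ k) (Nat.zero_le _) h2
  set b := c (φ k) (nndist (x 0) (x m))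
  have e1 := dist_comm (x 0) b
  have e2 := dist_comm (x 0) (x m)
  have e3 := dist_comm (x 0) (x (φ k))
  have e4 := dist_comm (x (φ k)) b
  rcases h.four_point (x 0) (x m) (x (φ k)) b with h3 | h3 <;> linarith

/-- A sequence with bounded steps that tends to infinity in a geodesic region is coarsely dense in
the corresponding ray. -/
theorem exists_dist_ray_le {x : ℕ → X} {γ : GeodesicRay X} {R C : ℝ}
    (hR : ∀ n, x n ∈ geodesicRegion γ R) (hC : ∀ n, dist (x n) (x (n + 1)) ≤ C)
    (hx : Tendsto (fun n => dist (x 0) (x n)) atTop atTop) :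
    ∃ M : ℝ, ∀ t : ℝ≥0, ∃ n, dist (γ t) (x n) ≤ M := by
  classical
  have hR0 : 0 ≤ R := Metric.infDist_nonneg.trans (hR 0).le
  have hC0 : 0 ≤ C := dist_nonneg.trans (hC 0)
  refine ⟨2 * R + C + 2 * dist (γ 0) (x 0), fun t => ?_⟩
  -- The first term at distance at least `t` overshoots by at most `C`, or is `x 0`.
  have hex : ∃ n, (t : ℝ) ≤ dist (γ 0) (x n) :=
    ((tendsto_dist_of_tendsto_dist hx (γ 0)).eventually_ge_atTop _).exists
  have hγt := γ.dist_zero t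
  refine ⟨Nat.find hex, ?_⟩
  have hspec := Nat.find_spec hex
  have hmin := fun m => Nat.find_min hex (m := m)
  generalize Nat.find hex = n at hspec hmin
  rcases n with _ | n
  · have := dist_triangle (γ t) (γ 0) (x 0)
    rw [dist_comm (γ t) (γ 0)] at this
    linarith
  · have h1 := hmin n (Nat.lt_succ_self n)
    have h2 := hC n
    have h3 := dist_triangle (γ 0) (x n) (x (n + 1))
    obtain ⟨s, hs⟩ := exists_dist_lt_of_mem_geodesicRegion (hR (n + 1))
    have hγs := γ.dist_zero s
    have h4 := dist_triangle (γ 0) (γ s) (x (n + 1))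
    have h5 := dist_triangle (γ 0) (x (n + 1)) (γ s)
    have h6 := dist_triangle (γ t) (γ s) (x (n + 1))
    rw [dist_comm (γ s)] at h4 h6
    have h7 : dist (γ t) (γ s) ≤ R + C := by
      rw [γ.isometry'.dist_eq, NNReal.dist_eq, abs_le]
      constructor <;> linarith
    have h8 : 0 ≤ dist (γ 0) (x 0) := dist_nonneg
    linarith

end Segments

/-! ### Sequences with linear progress -/

section Sequences

variable {X : Type*} [MetricSpace X]

theorem tendsto_dist_of_linear {x : ℕ → X} {c : ℝ} (hc : 0 < c) {n₀ : ℕ}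
    (hlow : ∀ n m : ℕ, n₀ ≤ n → c * m ≤ dist (x n) (x (n + m))) :
    Tendsto (fun n => dist (x 0) (x n)) atTop atTop := by
  refine tendsto_dist_of_tendsto_dist (o := x n₀) ((tendsto_add_atTop_iff_nat n₀).1 ?_) (x 0)
  refine tendsto_atTop_mono (fun n => ?_) (tendsto_natCast_atTop_atTop.const_mul_atTop hc)
  rw [add_comm n]
  exact hlow n₀ n le_rfl

/-- The first `n₀` terms, where no lower bound is assumed, are absorbed by the additive constant
`A⁻¹ * n₀ + C * n₀`. -/
theorem isDiscreteQuasiGeodesicRay_of_linear {x : ℕ → X} {C c : ℝ} (hc : 0 < c) {n₀ : ℕ}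
    (hC : ∀ n, dist (x n) (x (n + 1)) ≤ C)
    (hlow : ∀ n m : ℕ, n₀ ≤ n → c * m ≤ dist (x n) (x (n + m))) :
    IsDiscreteQuasiGeodesicRay x := by
  have hC0 : 0 ≤ C := dist_nonneg.trans (hC 0)
  set A : ℝ := max 1 (max C c⁻¹) with hA
  have hA1 : 1 ≤ A := le_max_left _ _
  have hAC : C ≤ A := (le_max_left _ _).trans (le_max_right _ _)
  have hAc : A⁻¹ ≤ c := by
    rw [inv_le_comm₀ (by linarith) hc]
    exact (le_max_right _ _).trans (le_max_right _ _)
  have hAi : 0 ≤ A⁻¹ := by positivity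
  have key : ∀ n m : ℕ, A⁻¹ * m - (A⁻¹ * n₀ + C * n₀) ≤ dist (x n) (x (n + m)) := by
    intro n m
    rcases le_total n₀ n with h | h
    · have h1 := hlow n m h
      have h2 : A⁻¹ * m ≤ c * m := by gcongr
      have : 0 ≤ A⁻¹ * n₀ + C * n₀ := by positivity
      linarith
    · obtain ⟨k, rfl⟩ := Nat.exists_eq_add_of_le h
      have hk : C * k ≤ C * ((n + k : ℕ) : ℝ) := by gcongr; omega
      rcases le_total k m with h' | h'
      · obtain ⟨l, rfl⟩ := Nat.exists_eq_add_of_le h'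
        have h1 := hlow (n + k) l le_rfl
        have h2 := dist_le_mul_of_step hC n k
        have h3 := dist_triangle_left (x (n + k)) (x (n + k + l)) (x n)
        rw [← add_assoc]
        have h4 : A⁻¹ * l ≤ c * l := by gcongr
        push_cast at *
        have : 0 ≤ A⁻¹ * n := by positivity
        linarith
      · have h1 : A⁻¹ * m ≤ A⁻¹ * ((n + k : ℕ) : ℝ) := by gcongr; omega
        have : 0 ≤ C * ((n + k : ℕ) : ℝ) := by positivity
        have := dist_nonneg (x := x n) (y := x (n + m))
        linarith
  have key' : ∀ n m : ℕ, A⁻¹ * |(n : ℝ) - m| - (A⁻¹ * n₀ + C * n₀) ≤ dist (x n) (x m) := by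
    intro n m
    rcases le_total n m with hnm | hnm
    · obtain ⟨k, rfl⟩ := Nat.exists_eq_add_of_le hnm
      simpa using key n k
    · obtain ⟨k, rfl⟩ := Nat.exists_eq_add_of_le hnm
      rw [dist_comm]
      simpa using key m k
  refine ⟨A, A⁻¹ * n₀ + C * n₀, hA1, by positivity, fun n m => ⟨key' n m, ?_⟩⟩
  have h1 := dist_le_mul_abs_of_step hC n m
  have h2 : C * |(n : ℝ) - m| ≤ A * |(n : ℝ) - m| := by gcongr
  have : 0 ≤ A⁻¹ * n₀ + C * n₀ := by positivity
  linarith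

/-- A sequence with bounded steps and convergent `m`-steps that makes linear progress is a
quasi-geodesic converging to a boundary point inside a geodesic region. -/
theorem exists_convergesTo_of_linear [ProperSpace X] (hgeod : IsGeodesicSpace X)
    (hhyp : IsGromovHyperbolic X) {x : ℕ → X} {C c : ℝ} (hc : 0 < c) {n₀ : ℕ}
    (hC : ∀ n, dist (x n) (x (n + 1)) ≤ C)
    (hlow : ∀ n m : ℕ, n₀ ≤ n → c * m ≤ dist (x n) (x (n + m)))
    (hs : ∀ m, ∃ s, Tendsto (fun n => dist (x n) (x (n + m))) atTop (𝓝 s)) :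
    ∃ ξ : GromovBoundary X, ConvergesTo x ξ ∧ InGeodesicRegion x ξ := by
  obtain ⟨δ, hδ, h⟩ := hhyp
  replace h : HyperbolicWith X δ := h
  choose s hs using hs
  obtain ⟨K, hK, hal⟩ := h.aligned_of_linear hδ hC hs hc fun m =>
    ge_of_tendsto (hs m) ((eventually_ge_atTop n₀).mono fun n hn => hlow n m hn)
  have hx := tendsto_dist_of_linear hc hlow
  obtain ⟨γ, R, hR, hreg⟩ := h.exists_region_of_aligned hδ hgeod hK hal hx
  exact ⟨γ.endpoint, h.convergesTo_of_region hreg hx, γ, R, hR, rfl, hreg⟩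

theorem InGeodesicRegion.of_dist_le {x y : ℕ → X} {ξ : GromovBoundary X}
    (h : InGeodesicRegion x ξ) {D : ℝ} (hD : ∀ n, dist (y n) (x n) ≤ D) : InGeodesicRegion y ξ := by
  obtain ⟨γ, R, hR, hγ, hx⟩ := h
  have hD0 : 0 ≤ D := dist_nonneg.trans (hD 0)
  refine ⟨γ, R + D, by linarith, hγ, fun n => ?_⟩
  have h1 := Metric.infDist_le_infDist_add_dist (s := Set.range γ) (x := y n) (y := x n)
  have h2 : Metric.infDist (x n) (Set.range γ) < R := hx n
  have h3 := hD n
  change Metric.infDist (y n) (Set.range γ) < R + D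
  linarith

/-- Two sequences in geodesic regions with the same vertex, the second one with bounded steps and
unbounded, cannot diverge from each other. -/
theorem exists_dist_le_of_inGeodesicRegion {z x : ℕ → X} {ξ : GromovBoundary X}
    (hz : InGeodesicRegion z ξ) (hx : InGeodesicRegion x ξ) {C : ℝ}
    (hC : ∀ n, dist (x n) (x (n + 1)) ≤ C)
    (hx' : Tendsto (fun n => dist (x 0) (x n)) atTop atTop) :
    ∃ M : ℝ, ∀ n, ∃ m, dist (z n) (x m) ≤ M := by
  obtain ⟨γ, R, hR, hγ, hz⟩ := hz
  obtain ⟨γ', R', hR', hγ', hx⟩ := hx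
  obtain ⟨B, hB⟩ : Asymptotic γ γ' := Quotient.exact (hγ.trans hγ'.symm)
  obtain ⟨M, hM⟩ := exists_dist_ray_le hx hC hx'
  refine ⟨R + B + M, fun n => ?_⟩
  obtain ⟨s, hs⟩ := exists_dist_lt_of_mem_geodesicRegion (hz n)
  obtain ⟨m, hm⟩ := hM s
  refine ⟨m, (dist_triangle4 (z n) (γ s) (γ' s) (x m)).trans ?_⟩
  have := hB s
  linarith

end Sequences

/-! ### Forward and backward orbits of a non-expanding map -/

section Orbits

variable {X : Type*} [MetricSpace X] {f : X → X}

theorem dist_iterate_le (hf : LipschitzWith 1 f) (n : ℕ) (a b : X) :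
    dist (f^[n] a) (f^[n] b) ≤ dist a b := by
  simpa using (hf.iterate n).dist_le_mul a b

/-- By Fekete the rate is the infimum of the quotients, not merely their limit, so the bound has no
error term and is uniform in `x`. -/
theorem divergenceRate_mul_le [Nonempty X] (hf : LipschitzWith 1 f) (x : X) (n : ℕ) :
    divergenceRate f * n ≤ dist x (f^[n] x) := by
  have hsub : Subadditive (fun n : ℕ => dist x (f^[n] x)) := by
    intro m n
    have h1 := dist_triangle x (f^[m] x) (f^[m + n] x)
    have h2 := dist_iterate_le hf m x (f^[n] x)
    rw [← Function.iterate_add_apply] at h2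
    exact h1.trans (by gcongr)
  have hbdd : BddBelow (Set.range fun n : ℕ => dist x (f^[n] x) / n) :=
    ⟨0, by rintro _ ⟨n, rfl⟩; positivity⟩
  have heq : hsub.lim = divergenceRate f :=
    tendsto_nhds_unique (hsub.tendsto_lim hbdd) (tendsto_divergenceRate hf x)
  rcases Nat.eq_zero_or_pos n with rfl | hn
  · simp
  · have := hsub.lim_le_div hbdd hn.ne'
    rwa [heq, le_div_iff₀ (by exact_mod_cast hn)] at this

theorem dist_iterate_step_le (hf : LipschitzWith 1 f) (x : X) (n : ℕ) :
    dist (f^[n] x) (f^[n + 1] x) ≤ dist x (f x) := by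
  simpa [Function.iterate_succ_apply] using dist_iterate_le hf n x (f x)

theorem divergenceRate_mul_le_forward [Nonempty X] (hf : LipschitzWith 1 f) (x : X) (n m : ℕ) :
    divergenceRate f * m ≤ dist (f^[n] x) (f^[n + m] x) := by
  rw [add_comm n, Function.iterate_add_apply]
  exact divergenceRate_mul_le hf _ m

theorem exists_tendsto_forward_step (hf : LipschitzWith 1 f) (x : X) (m : ℕ) :
    ∃ s, Tendsto (fun n => dist (f^[n] x) (f^[n + m] x)) atTop (𝓝 s) := by
  refine ⟨_, tendsto_atTop_ciInf (antitone_nat_of_succ_le fun n => ?_)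
    ⟨0, by rintro _ ⟨n, rfl⟩; exact dist_nonneg⟩⟩
  have := hf.dist_le_mul (f^[n] x) (f^[n + m] x)
  rw [← Function.iterate_succ_apply' f, ← Function.iterate_succ_apply' f] at this
  have e : n + 1 + m = (n + m).succ := by omega
  simpa [e] using this

theorem IsBackwardOrbit.iterate {X : Type*} {f : X → X} {z : ℕ → X} (hz : IsBackwardOrbit f z) (n m : ℕ) :
    f^[m] (z (n + m)) = z n := by
  induction m with
  | zero => rfl
  | succ m ih => rw [Function.iterate_succ_apply, ← add_assoc, hz, ih]

/-- Applying `f` lowers both indices by one without increasing the distance. -/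
theorem IsBackwardOrbit.monotone_step (hf : LipschitzWith 1 f) {z : ℕ → X}
    (hz : IsBackwardOrbit f z) (m : ℕ) : Monotone fun n => dist (z n) (z (n + m)) := by
  refine monotone_nat_of_le_succ fun n => ?_
  have h := hf.dist_le_mul (z (n + 1)) (z (n + m + 1))
  rw [hz, hz] at h
  have e : n + 1 + m = n + m + 1 := by omega
  simpa [e] using h

theorem IsBackwardOrbit.exists_step_le (hf : LipschitzWith 1 f) {z : ℕ → X}
    (hz : IsBackwardOrbit f z) (hb : HasBoundedStep z) :
    ∃ C, ∀ n, dist (z n) (z (n + 1)) ≤ C := by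
  refine ⟨(backwardStep 1 z).toReal, fun n => ?_⟩
  have hmono : Monotone fun n => edist (z n) (z (n + 1)) := fun a b hab => by
    have := hz.monotone_step hf 1 hab
    simp only [edist_dist]
    exact ENNReal.ofReal_le_ofReal this
  have := hmono.ge_of_tendsto (tendsto_backwardStep hf hz 1) n
  rw [dist_edist]
  exact ENNReal.toReal_mono hb.ne this

theorem IsBackwardOrbit.exists_tendsto_step (hf : LipschitzWith 1 f) {z : ℕ → X}
    (hz : IsBackwardOrbit f z) {C : ℝ} (hC : ∀ n, dist (z n) (z (n + 1)) ≤ C) (m : ℕ) :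
    ∃ s, Tendsto (fun n => dist (z n) (z (n + m))) atTop (𝓝 s) :=
  ⟨_, tendsto_atTop_ciSup (hz.monotone_step hf m)
    ⟨C * m, by rintro _ ⟨n, rfl⟩; exact dist_le_mul_of_step hC n m⟩⟩

theorem IsBackwardOrbit.divergenceRate_mul_le [Nonempty X] (hf : LipschitzWith 1 f) {z : ℕ → X}
    (hz : IsBackwardOrbit f z) (n m : ℕ) :
    divergenceRate f * m ≤ dist (z n) (z (n + m)) := by
  have := GromovDynamics.divergenceRate_mul_le hf (z (n + m)) m
  rwa [hz.iterate, dist_comm] at this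

/-- `f^[m] (z 0)` is the iterate of order `m + n` of `z n`; this separates the backward orbit from
the forward one. -/
theorem IsBackwardOrbit.divergenceRate_mul_le_forward [Nonempty X] (hf : LipschitzWith 1 f)
    {z : ℕ → X} (hz : IsBackwardOrbit f z) (n m : ℕ) :
    divergenceRate f * (n + m) ≤ dist (z n) (f^[m] (z 0)) := by
  have := GromovDynamics.divergenceRate_mul_le hf (z n) (m + n)
  have e := hz.iterate 0 n
  rw [zero_add] at e
  rw [Function.iterate_add_apply, e] at this
  push_cast at this
  rwa [add_comm (n : ℝ)]

/-- A dilation larger than one forces linear growth along a backward orbit. -/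
theorem IsBackwardOrbit.exists_linear_of_one_lt_dilation {z : ℕ → X} (hz : IsBackwardOrbit f z)
    {η : GromovBoundary X} (hη : ConvergesTo z η) {p : X} (hp : 1 < dilation f η p) :
    ∃ a : ℝ, 0 < a ∧ ∃ n₀ : ℕ, ∀ n m : ℕ, n₀ ≤ n → a * m ≤ dist (z n) (z (n + m)) := by
  rw [dilation, EReal.one_lt_exp_iff] at hp
  obtain ⟨a, ha0, ha⟩ := EReal.lt_iff_exists_real_btwn.1 hp
  have hev := eventually_lt_of_lt_liminf ha
  -- `z` is one of the sequences defining the trace, so the liminf bound holds eventually along it.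
  have hle : map z atTop ≤ nhdsTrace η := le_iSup₂_of_le z hη le_rfl
  obtain ⟨n₀, hn₀⟩ := eventually_atTop.1 (eventually_map.1 (hle hev))
  refine ⟨a, by exact_mod_cast ha0, n₀, fun n m hn => ?_⟩
  -- Since `f (z (n + 1)) = z n`, the bound telescopes.
  have hgrow : a * m ≤ dist (z (n + m)) p - dist (z n) p := by
    induction m with
    | zero => simp
    | succ m ih =>
      have h1 := hn₀ (n + m + 1) (by omega)
      rw [hz, EReal.coe_lt_coe_iff] at h1
      push_cast
      rw [← add_assoc]
      linarith
  have := dist_triangle_left (z (n + m)) p (z n)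
  linarith

end Orbits

end GromovDynamics

/-! ### The main theorem -/

open GromovDynamics in
theorem mainTheorem9 {X : Type*} [MetricSpace X] [Nonempty X] [ProperSpace X]
    (hgeod : GromovDynamics.IsGeodesicSpace X) (hhyp : GromovDynamics.IsGromovHyperbolic X)
    (f : X → X) (hf : LipschitzWith 1 f) :
    (0 < GromovDynamics.divergenceRate f →
      (∃! ζ : GromovDynamics.GromovBoundary X, GromovDynamics.IsDenjoyWolffPoint f ζ) ∧
      ∀ ζ : GromovDynamics.GromovBoundary X, GromovDynamics.IsDenjoyWolffPoint f ζ →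
        (∀ x : X,
          GromovDynamics.IsDiscreteQuasiGeodesicRay (fun n => f^[n] x) ∧
          GromovDynamics.InGeodesicRegion (fun n => f^[n] x) ζ) ∧
        (∀ z : ℕ → X, GromovDynamics.IsBackwardOrbit f z → GromovDynamics.HasBoundedStep z →
          GromovDynamics.IsDiscreteQuasiGeodesicRay z ∧
          ∃ η : GromovDynamics.GromovBoundary X,
            GromovDynamics.ConvergesTo z η ∧ η ≠ ζ ∧ GromovDynamics.InGeodesicRegion z η)) ∧
    (∀ (z : ℕ → X) (η : GromovDynamics.GromovBoundary X),
      GromovDynamics.IsBackwardOrbit f z → GromovDynamics.HasBoundedStep z →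
      GromovDynamics.IsBoundaryRegularFixedPoint f η → GromovDynamics.ConvergesTo z η →
      (∃ p : X, 1 < GromovDynamics.dilation f η p) →
        GromovDynamics.IsDiscreteQuasiGeodesicRay z ∧
        GromovDynamics.InGeodesicRegion z η) := by
  constructor
  · intro hc
    have hforward : ∀ x : X, ∃ ξ : GromovBoundary X,
        ConvergesTo (fun n => f^[n] x) ξ ∧ InGeodesicRegion (fun n => f^[n] x) ξ := fun x =>
      exists_convergesTo_of_linear hgeod hhyp hc (n₀ := 0) (dist_iterate_step_le hf x)
        (fun n m _ => divergenceRate_mul_le_forward hf x n m) (exists_tendsto_forward_step hf x)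
    have hinf : ∀ x : X, Tendsto (fun n => dist (f^[0] x) (f^[n] x)) atTop atTop := fun x =>
      tendsto_dist_of_linear (x := fun n => f^[n] x) hc (n₀ := 0)
        fun n m _ => divergenceRate_mul_le_forward hf x n m
    have hregion : ∀ ζ : GromovBoundary X, IsDenjoyWolffPoint f ζ → ∀ x : X,
        InGeodesicRegion (fun n => f^[n] x) ζ := by
      intro ζ hζ x
      obtain ⟨ξ, hξ, hreg⟩ := hforward x
      rwa [(hζ x).unique hgeod hξ]
    refine ⟨?_, fun ζ hζ => ⟨fun x => ⟨?_, hregion ζ hζ x⟩, fun z hz hb => ?_⟩⟩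
    · obtain ⟨ξ, hξ, hreg⟩ := hforward (Classical.arbitrary X)
      refine ⟨ξ, fun x => ?_, fun ξ' hξ' => (hξ' _).unique hgeod hξ⟩
      -- Two forward orbits stay within the distance of their starting points, so all of them share
      -- a vertex.
      obtain ⟨γ, R, -, rfl, hR⟩ := hreg.of_dist_le fun n => dist_iterate_le hf n x _
      obtain ⟨δ, -, h⟩ := hhyp
      exact HyperbolicWith.convergesTo_of_region h hR (hinf x)
    · exact isDiscreteQuasiGeodesicRay_of_linear hc (n₀ := 0) (dist_iterate_step_le hf x)
        fun n m _ => divergenceRate_mul_le_forward hf x n m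
    · obtain ⟨C, hC⟩ := hz.exists_step_le hf hb
      have hlow : ∀ n m : ℕ, 0 ≤ n → divergenceRate f * m ≤ dist (z n) (z (n + m)) :=
        fun n m _ => hz.divergenceRate_mul_le hf n m
      obtain ⟨η, hη, hreg⟩ := exists_convergesTo_of_linear hgeod hhyp hc hC hlow
        (hz.exists_tendsto_step hf hC)
      refine ⟨isDiscreteQuasiGeodesicRay_of_linear hc hC hlow, η, hη, ?_, hreg⟩
      rintro rfl
      obtain ⟨M, hM⟩ := exists_dist_le_of_inGeodesicRegion hreg (hregion η hζ (z 0))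
        (dist_iterate_step_le hf (z 0)) (hinf (z 0))
      -- At this `n`, `z n` is farther than `M` from every point of the forward orbit of `z 0`.
      obtain ⟨n, hn⟩ := exists_nat_gt (M / divergenceRate f)
      obtain ⟨m, hm⟩ := hM n
      rw [div_lt_iff₀ hc] at hn
      have h1 := hz.divergenceRate_mul_le_forward hf n m
      have h2 : 0 ≤ divergenceRate f * m := by positivity
      linarith
  · rintro z η hz hb - hη ⟨p, hp⟩
    obtain ⟨C, hC⟩ := hz.exists_step_le hf hb
    obtain ⟨a, ha, n₀, hlow⟩ := hz.exists_linear_of_one_lt_dilation hη hp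
    refine ⟨isDiscreteQuasiGeodesicRay_of_linear ha hC hlow, ?_⟩
    obtain ⟨ξ, hξ, hreg⟩ := exists_convergesTo_of_linear hgeod hhyp ha hC hlow
      (hz.exists_tendsto_step hf hC)
    rwa [hη.unique hgeod hξ]
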